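/- Let $X$ be a path-connected CW complex, let $q\colon \widehat X \to X$ be a covering with $\widehat X$ connected, and let $\widetilde p\colon \widetilde X \to X$ be a universal covering, i.e. a covering with $\widetilde X$ simply connected. Choose basepoints $x_0\in X$, $\hat x_0\in q^{-1}(x_0)$ and $\tilde x_0\in \widetilde p^{-1}(x_0)$, put $\pi_1(X)=\pi_1(X,x_0)$ (a discrete group), and regard $\pi_1(X)$ as acting on $\widetilde X$ by deck transformations, using the basepoint $\tilde x_0$. Let $\pi_1(\widehat X)$ denote the subgroup $q_*\pi_1(\widehat X,\hat x_0)$ of $\pi_1(X)$. Then $\pi_1(X)$ acts on $\widetilde X$ by continuous maps, and $$\operatorname{secat}(q) = \mathcal A\text{-}\operatorname{genus}(\widetilde X),\qquad \mathcal A=\{\pi_1(X)/\pi_1(\widehat X)\},$$ an equality in $\{0,1,2,\dots\}\cup\{\infty\}$, where $\pi_1(X)/\pi_1(\widehat X)$ is the discrete $\pi_1(X)$-space of left cosets. Here the sectional category $\operatorname{secat}(f)$ of a map $f\colon E\to B$ is the smallest integer $n\ge 0$ such that $B$ has an open cover $U_0,\dots,U_n$ with continuous maps $s_i\colon U_i\to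 E$ for which $f\circ s_i$ is homotopic to the inclusion $U_i\hookrightarrow B$ for every $0\le i\le n$ (and $\infty$ if there is no such $n$). For a discrete group $G$ and a family $\mathcal A$ of $G$-spaces, the $\mathcal A$-genus of a $G$-space $Y$ is the smallest integer $k\ge 0$ such that $Y$ has a cover by open $G$-invariant subsets $U_0,\dots,U_k$ with, for every $0\le i\le k$, some $A_i\in\mathcal A$ and a continuous $G$-equivariant map $U_i\to A_i$ (and $\infty$ if there is no such $k$). -/

import Mathlib

/-! ### Sectional category -/

/-- The map `f` has sectional category at most `n`: there is an open cover `U 0, …, U n` of the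
target with continuous maps `s i : U i → X` such that `f ∘ s i` is homotopic to the inclusion. -/
def SecatLE {X Y : Type*} [TopologicalSpace X] [TopologicalSpace Y] (f : C(X, Y)) (n : ℕ) : Prop :=
  ∃ U : Fin (n + 1) → Set Y, (∀ i, IsOpen (U i)) ∧ (⋃ i, U i) = Set.univ ∧
    ∀ i, ∃ s : C(U i, X),
      (f.comp s).Homotopic (⟨Subtype.val, continuous_subtype_val⟩ : C(U i, Y))

/-- The (reduced) sectional category: the least `n` with `SecatLE f n`, and `⊤` if none exists. -/
noncomputable def secat {X Y : Type*} [TopologicalSpace X] [TopologicalSpace Y] (f : C(X, Y)) :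
    ℕ∞ :=
  ⨅ (n : ℕ) (_ : SecatLE f n), (n : ℕ∞)

/-! ### The genus of a `G`-space with respect to a family of `G`-spaces, `G` discrete -/

/-- There is an open cover `U 0, …, U k` of `Y` by `G`-invariant subsets, each of which admits a
continuous `G`-equivariant map to a member of the family `A`. -/
def GenusLE (G : Type*) [Group G] {ι : Type*} (A : ι → Type*) [∀ a, TopologicalSpace (A a)]
    [∀ a, MulAction G (A a)] (Y : Type*) [TopologicalSpace Y] [MulAction G Y] (k : ℕ) : Prop :=
  ∃ U : Fin (k + 1) → SubMulAction G Y, (∀ i, IsOpen (U i : Set Y)) ∧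
    (⋃ i, (U i : Set Y)) = Set.univ ∧
    ∀ i, ∃ (a : ι) (φ : U i →[G] A a), Continuous φ

/-- The genus of the `G`-space `Y` with respect to the family `A`: the least `k` with
`GenusLE G A Y k`, and `⊤` if none exists. -/
noncomputable def genus (G : Type*) [Group G] {ι : Type*} (A : ι → Type*)
    [∀ a, TopologicalSpace (A a)] [∀ a, MulAction G (A a)] (Y : Type*) [TopologicalSpace Y]
    [MulAction G Y] : ℕ∞ :=
  ⨅ (k : ℕ) (_ : GenusLE G A Y k), (k : ℕ∞)

/-- The set `G ⧸ H` of left cosets as a discrete `G`-space. -/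
def CosetSpace {G : Type*} [Group G] (H : Subgroup G) : Type _ := G ⧸ H

instance {G : Type*} [Group G] (H : Subgroup G) : MulAction G (CosetSpace H) :=
  inferInstanceAs (MulAction G (G ⧸ H))

instance {G : Type*} [Group G] (H : Subgroup G) : TopologicalSpace (CosetSpace H) := ⊥

instance {G : Type*} [Group G] (H : Subgroup G) : DiscreteTopology (CosetSpace H) := ⟨rfl⟩

/-! ### The image of the fundamental group of a covering space -/

/-- The subgroup `q_* π₁(E, e₀)` of `π₁(X, x₀)`, where `e₀` lies over `x₀`. -/
noncomputable def coveringSubgroup {E X : Type*} [TopologicalSpace E] [TopologicalSpace X] (q : C(E, X))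
    {x₀ : X} (e₀ : q ⁻¹' {x₀}) : Subgroup (FundamentalGroup X x₀) :=
  (FundamentalGroup.mapOfEq q (show q e₀.1 = x₀ from e₀.2)).range

/-! ### The deck transformation action on a universal covering

In Mathlib the product `g * h` of two loop classes is "first `h`, then `g`". With this convention
the deck action is a left action when `g` is the deck transformation that carries the endpoint of
the lift of `g` at `e₀` back to `e₀`, equivalently carries `e₀` to the endpoint of the lift of
`g⁻¹`. Under the anti-isomorphism `g ↦ g⁻¹` with the group of the opposite convention this is the
usual left action, in which the loop `g` carries `e₀` to the endpoint of its lift. -/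

section Deck

variable {E X : Type*} [TopologicalSpace E] [TopologicalSpace X] [SimplyConnectedSpace E]
  {p : E → X} (hp : IsCoveringMap p) {x₀ : X} (e₀ : p ⁻¹' {x₀})

/-- The class of the projection to `X` of a path from `e₀` to `y`; it does not depend on the
path, as `E` is simply connected. -/
noncomputable def projClass (y : E) : Path.Homotopic.Quotient x₀ (p y) :=
  (Path.Homotopic.Quotient.map
    (Path.Homotopic.Quotient.mk (PathConnectedSpace.somePath e₀.1 y))
    ⟨p, hp.continuous⟩).cast (show x₀ = p e₀.1 from e₀.2.symm) rfl

/-- The deck transformation of `g`: if `δ` is the projection of a path from `e₀` to `y`, then `y`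
is sent to the endpoint of the lift at `e₀` of the path "first `g⁻¹`, then `δ`". -/
noncomputable def deckMap (g : FundamentalGroup X x₀) (y : E) : E :=
  (hp.monodromy ((FundamentalGroup.toPath g⁻¹).trans (projClass hp e₀ y)) e₀).1

theorem monodromy_projClass (y : E) : hp.monodromy (projClass hp e₀ y) e₀ = ⟨y, rfl⟩ := by
  refine hp.monodromy_eq_of_map_eq
    (Path.Homotopic.Quotient.mk (PathConnectedSpace.somePath e₀.1 y)) ?_
  exact ((Path.Homotopic.Quotient.cast_cast ..).trans
    (Path.Homotopic.Quotient.cast_rfl_rfl _)).symm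

theorem projClass_monodromy {x : X} (γ : Path.Homotopic.Quotient x₀ x) :
    projClass hp e₀ (hp.monodromy γ e₀).1 = γ.cast rfl (hp.monodromy γ e₀).2 := by
  unfold projClass
  rw [Subsingleton.elim (Path.Homotopic.Quotient.mk _) (hp.liftPathQuotient γ e₀),
    hp.map_liftPathQuotient]
  exact Path.Homotopic.Quotient.cast_cast ..

theorem deckMap_monodromy (g : FundamentalGroup X x₀) {x : X}
    (γ : Path.Homotopic.Quotient x₀ x) :
    deckMap hp e₀ g (hp.monodromy γ e₀).1
      = (hp.monodromy ((FundamentalGroup.toPath g⁻¹).trans γ) e₀).1 := by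
  have key : ∀ {z : X} (h : z = x),
      (hp.monodromy ((FundamentalGroup.toPath g⁻¹).trans (γ.cast rfl h)) e₀).1
        = (hp.monodromy ((FundamentalGroup.toPath g⁻¹).trans γ) e₀).1 := by
    rintro z rfl
    simp
  unfold deckMap
  rw [projClass_monodromy]
  exact key _

/-- Each `deckMap hp e₀ g` is a map over `X`. -/
theorem proj_deckMap (g : FundamentalGroup X x₀) (y : E) : p (deckMap hp e₀ g y) = p y :=
  (hp.monodromy ((FundamentalGroup.toPath g⁻¹).trans (projClass hp e₀ y)) e₀).2

/-- The left action of `π₁(X, x₀)` on the universal covering space `E` by deck transformations,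
for the basepoint `e₀` over `x₀`. -/
@[reducible] noncomputable def deckAction : MulAction (FundamentalGroup X x₀) E where
  smul := deckMap hp e₀
  one_smul y := by
    change deckMap hp e₀ 1 y = y
    unfold deckMap
    rw [hp.monodromy_trans_apply, inv_one, FundamentalGroup.one_def, hp.monodromy_refl, id,
      monodromy_projClass]
  mul_smul g h y := by
    change deckMap hp e₀ (g * h) y = deckMap hp e₀ g (deckMap hp e₀ h y)
    conv_rhs => rw [deckMap.eq_1 hp e₀ h y, deckMap_monodromy]
    have hinv : FundamentalGroup.toPath (g * h)⁻¹
        = (FundamentalGroup.toPath g⁻¹).trans (FundamentalGroup.toPath h⁻¹) := mul_inv_rev g h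
    unfold deckMap
    rw [hinv]
    simp only [hp.monodromy_trans_apply]

/-- The deck transformation of `g` carries the endpoint of the lift of `g` at `e₀` to `e₀`. -/
theorem deckMap_endpoint (g : FundamentalGroup X x₀) :
    deckMap hp e₀ g (hp.monodromy (FundamentalGroup.toPath g) e₀).1 = e₀.1 := by
  have hinv : (FundamentalGroup.toPath g⁻¹).trans (FundamentalGroup.toPath g)
      = Path.Homotopic.Quotient.refl x₀ := mul_inv_cancel g
  rw [deckMap_monodromy, hinv, hp.monodromy_refl, id]

end Deck

/-! Write `G` for the fundamental group and `H` for the subgroup of `q`. Monodromy identifies the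
fiber of `q` with `G / H` (`cosetEquivFiber`). The pullback of `q` to the simply connected `E` is
trivial: `transport` assigns to a coset `c` and a point `y` a point `T(c, y)` over `p y`. It is
continuous in `y`, bijective from `G / H` onto the fiber of `q` over `p y`, and satisfies `T(g c, g
y) = T(c, y)` (`transport_coset_deckMap`).

A homotopy section of a covering deforms to a strict section `s`. Then `T(φ y, y) = s (p y)` matches
sections over `U` with equivariant maps `φ` from the preimage of `U` to `G / H`. Covers correspond
under preimage and image by `p`, so the two numerical conditions agree for each `n`. -/

open Set Topology

/-! ### Local path-connectedness -/

/-- A CW complex is locally path-connected. -/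
theorem locallyPathConnectedSpace_of_CWComplex {X : Type*} [TopologicalSpace X] [T2Space X]
    [CWComplex (univ : Set X)] : LocallyPathConnectedSpace X := by
  let Y := Σ i : (Σ n, RelCWComplex.cell (univ : Set X) n), Metric.closedBall (0 : Fin i.1 → ℝ) 1
  let f : Y → X := fun y => RelCWComplex.map (C := univ) y.1.1 y.1.2 y.2.1
  have hf : Continuous f := continuous_sigma fun i =>
    (RelCWComplex.continuousOn (C := (univ : Set X)) i.1 i.2).domRestrict
  have hsurj : Function.Surjective f := fun x => by
    have hx : x ∈ (univ : Set X) := mem_univ x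
    rw [← RelCWComplex.union' (C := (univ : Set X))] at hx
    simp only [mem_iUnion, empty_union] at hx
    obtain ⟨n, j, z, hz, rfl⟩ := hx
    exact ⟨⟨⟨n, j⟩, ⟨z, hz⟩⟩, rfl⟩
  -- This is the weak topology: a closed set pulled back to a compact ball has compact image, which
  -- is closed since `X` is Hausdorff.
  have hquot : IsQuotientMap f := by
    refine isQuotientMap_iff_isClosed.2 ⟨hsurj, fun A => ⟨fun hA => hA.preimage hf, fun hA => ?_⟩⟩
    refine RelCWComplex.closed' (C := (univ : Set X)) A (subset_univ A)
      ⟨fun n j => ?_, by simp⟩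
    have hcl : IsClosed ((fun z : Metric.closedBall (0 : Fin n → ℝ) 1 =>
        RelCWComplex.map (C := (univ : Set X)) n j z.1) ⁻¹' A) :=
      hA.preimage (continuous_sigmaMk (σ := fun i : (Σ n, RelCWComplex.cell (univ : Set X) n) =>
        Metric.closedBall (0 : Fin i.1 → ℝ) 1) (i := ⟨n, j⟩))
    have hcomp := hcl.isCompact.image
      (RelCWComplex.continuousOn (C := (univ : Set X)) n j).domRestrict
    convert hcomp.isClosed using 1
    ext x
    constructor
    · rintro ⟨hx, z, hz, rfl⟩
      exact ⟨⟨z, hz⟩, hx, rfl⟩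
    · rintro ⟨z, hz, rfl⟩
      exact ⟨hz, z.1, z.2, rfl⟩
  have : ∀ i : (Σ n, RelCWComplex.cell (univ : Set X) n),
      LocallyPathConnectedSpace (Metric.closedBall (0 : Fin i.1 → ℝ) 1) := fun i =>
    (convex_closedBall _ _).locallyPathConnectedSpace
  exact hquot.locallyPathConnectedSpace

theorem IsLocalHomeomorph.locallyPathConnectedSpace {E X : Type*} [TopologicalSpace E]
    [TopologicalSpace X] [LocallyPathConnectedSpace X] {f : E → X} (hf : IsLocalHomeomorph f) :
    LocallyPathConnectedSpace E := by
  let _ : ChartedSpace X E :=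
    { atlas := range fun e => (hf e).choose
      chartAt := fun e => (hf e).choose
      mem_chart_source := fun e => (hf e).choose_spec.1
      chart_mem_atlas := fun e => mem_range_self e }
  exact ChartedSpace.locallyPathConnectedSpace X E

/-! ### Monodromy -/

theorem IsCoveringMap.surjective_of_nonempty {E X : Type*} [TopologicalSpace E]
    [TopologicalSpace X] [Nonempty E] [PathConnectedSpace X] {q : E → X} (hq : IsCoveringMap q) :
    Function.Surjective q := fun x => by
  obtain ⟨e⟩ := ‹Nonempty E›
  exact ⟨_, (hq.monodromy (.mk (PathConnectedSpace.somePath (q e) x)) ⟨e, rfl⟩).2⟩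

section Monodromy

variable {E X : Type*} [TopologicalSpace E] [TopologicalSpace X] {q : C(E, X)}
  (hq : IsCoveringMap q)

theorem IsCoveringMap.monodromy_cast_val {x y y' : X} (γ : Path.Homotopic.Quotient x y)
    (h : y' = y) (a : q ⁻¹' {x}) :
    (hq.monodromy (γ.cast rfl h) a).1 = (hq.monodromy γ a).1 := by
  subst h
  simp

theorem IsCoveringMap.exists_monodromy_eq [PathConnectedSpace E] {x y : X}
    (a : q ⁻¹' {x}) (b : q ⁻¹' {y}) : ∃ γ : Path.Homotopic.Quotient x y, hq.monodromy γ a = b := by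
  obtain ⟨a, rfl⟩ := a
  obtain ⟨b, rfl⟩ := b
  exact ⟨_, hq.monodromy_map (.mk (PathConnectedSpace.somePath a b))⟩

/-- A loop upstairs is the lift of its own projection; conversely, a lift that closes up is a loop
upstairs projecting to `g`. -/
theorem mem_coveringSubgroup_iff {x₀ : X} (a₀ : q ⁻¹' {x₀}) (g : FundamentalGroup X x₀) :
    g ∈ coveringSubgroup q a₀ ↔ hq.monodromy g.toPath a₀ = a₀ := by
  constructor
  · rintro ⟨γ, rfl⟩
    refine hq.monodromy_eq_of_map_eq γ ?_
    rw [FundamentalGroup.toPath, FundamentalGroup.toArrow, FundamentalGroup.mapOfEq_apply]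
    exact ((Path.Homotopic.Quotient.cast_cast ..).trans
      (Path.Homotopic.Quotient.cast_rfl_rfl _)).symm
  · intro h
    refine ⟨(hq.liftPathQuotient g.toPath a₀).cast rfl congr(($h.symm).1), ?_⟩
    rw [FundamentalGroup.mapOfEq_apply]
    -- The endpoint of the lift is generalized to `z` so that substitution can remove the casts.
    have h2 : ∀ (z : E) (hz : z = a₀.1) (hz' : a₀.1 = z) (hqz : q z = x₀)
        (γ : Path.Homotopic.Quotient a₀.1 z),
        γ.map q = g.toPath.cast a₀.2 hqz →
        ((γ.cast rfl hz').map q).cast a₀.2.symm a₀.2.symm = g.toPath := by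
      rintro z rfl - hqz γ hγ
      rw [Path.Homotopic.Quotient.cast_rfl_rfl, hγ]
      exact (Path.Homotopic.Quotient.cast_cast ..).trans
        (Path.Homotopic.Quotient.cast_rfl_rfl _)
    exact h2 _ congr(($h).1) _ (hq.monodromy g.toPath a₀).2 _ (hq.map_liftPathQuotient _ _)

theorem IsCoveringMap.monodromy_mul {x₀ : X} (g h : FundamentalGroup X x₀) (a : q ⁻¹' {x₀}) :
    hq.monodromy (g * h).toPath a = hq.monodromy g.toPath (hq.monodromy h.toPath a) :=
  hq.monodromy_trans_apply ..

theorem IsCoveringMap.monodromy_one {x₀ : X} (a : q ⁻¹' {x₀}) :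
    hq.monodromy (1 : FundamentalGroup X x₀).toPath a = a :=
  congrFun hq.monodromy_refl a

/-- The fiber of a path-connected covering is the set of cosets of the subgroup of the covering. -/
noncomputable def cosetEquivFiber [PathConnectedSpace E] {x₀ : X} (a₀ : q ⁻¹' {x₀}) :
    CosetSpace (coveringSubgroup q a₀) ≃ q ⁻¹' {x₀} :=
  have key (g h : FundamentalGroup X x₀) : g⁻¹ * h ∈ coveringSubgroup q a₀ ↔
      hq.monodromy g.toPath a₀ = hq.monodromy h.toPath a₀ := by
    rw [mem_coveringSubgroup_iff hq, hq.monodromy_mul,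
      ← (hq.monodromy_bijective g.toPath).1.eq_iff, ← hq.monodromy_mul, mul_inv_cancel,
      hq.monodromy_one, eq_comm]
  Equiv.ofBijective
    (Quotient.lift (fun g : FundamentalGroup X x₀ => hq.monodromy g.toPath a₀)
      fun g h hgh => (key g h).1 (QuotientGroup.leftRel_apply.1 hgh))
    ⟨by
      rintro ⟨g⟩ ⟨h⟩ hgh
      exact Quotient.sound (QuotientGroup.leftRel_apply.2 ((key g h).2 hgh)),
    fun b => by
      obtain ⟨γ, hγ⟩ := hq.exists_monodromy_eq a₀ b
      exact ⟨Quotient.mk _ γ, hγ⟩⟩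

theorem cosetEquivFiber_smul [PathConnectedSpace E] {x₀ : X} (a₀ : q ⁻¹' {x₀})
    (g : FundamentalGroup X x₀) (c : CosetSpace (coveringSubgroup q a₀)) :
    cosetEquivFiber hq a₀ (g • c) = hq.monodromy g.toPath (cosetEquivFiber hq a₀ c) := by
  obtain ⟨h⟩ := c
  exact hq.monodromy_mul g h a₀

end Monodromy

/-! ### Transport along paths in the universal covering -/

section Transport

variable {E X F : Type*} [TopologicalSpace E] [TopologicalSpace X] [TopologicalSpace F]
  [SimplyConnectedSpace E] {p : C(E, X)} (hp : IsCoveringMap p) {x₀ : X} (e₀ : p ⁻¹' {x₀})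
  {q : C(F, X)} (hq : IsCoveringMap q)

/-- The endpoint of the lift at `a` of the projection of a path from `e₀` to `y`. -/
noncomputable def transport (a : q ⁻¹' {x₀}) (y : E) : F := (hq.monodromy (projClass hp e₀ y) a).1

theorem proj_transport (a : q ⁻¹' {x₀}) (y : E) : q (transport hp e₀ hq a y) = p y :=
  (hq.monodromy (projClass hp e₀ y) a).2

theorem transport_injective (y : E) :
    Function.Injective fun a : q ⁻¹' {x₀} => transport hp e₀ hq a y :=
  Subtype.val_injective.comp (hq.monodromy_bijective _).1

theorem exists_transport_eq {y : E} {z : F} (h : q z = p y) :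
    ∃ a : q ⁻¹' {x₀}, transport hp e₀ hq a y = z := by
  obtain ⟨a, ha⟩ := (hq.monodromy_bijective (projClass hp e₀ y)).2 ⟨z, h⟩
  exact ⟨a, congrArg Subtype.val ha⟩

/-- The lifting criterion gives a lift `L` of `p` through `q` with `L e₀ = a`. It carries a path
from `e₀` to `y` to the lift of its projection at `a`, so `transport` is `L`. -/
theorem continuous_transport [LocallyPathConnectedSpace E] (a : q ⁻¹' {x₀}) :
    Continuous (transport hp e₀ hq a) := by
  obtain ⟨L, ⟨hL₀, hL⟩, -⟩ := hq.existsUnique_continuousMap_lifts p e₀.1 a.1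
    (a.2.trans e₀.2.symm)
  have hLp : q.comp L = p := DFunLike.coe_injective hL
  convert L.continuous
  ext y
  have h₀ : L y = (⟨L y, congrFun hL y⟩ : q ⁻¹' {p y}).1 := rfl
  rw [h₀]
  refine congrArg Subtype.val (hq.monodromy_eq_of_map_eq (ey := ⟨L y, congrFun hL y⟩)
    (((Path.Homotopic.Quotient.mk (PathConnectedSpace.somePath e₀.1 y)).map L).cast
      hL₀.symm rfl) ?_)
  have key : ∀ {x : X} {z : F} (h : x = q z) (h' : p y = q (L y)) (hz : z = L e₀.1)
      (hx : x = p e₀.1) (Γ : Path.Homotopic.Quotient e₀.1 y),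
      ((Γ.map L).cast hz rfl).map q = ((Γ.map p).cast hx rfl).cast h.symm h'.symm := by
    subst hLp
    rintro x z rfl - rfl - ⟨γ⟩
    rfl
  exact key a.2.symm (congrFun hL y).symm hL₀.symm e₀.2.symm _

theorem deckMap_eq_transport (g : FundamentalGroup X x₀) :
    deckMap hp e₀ g = transport hp e₀ hp (hp.monodromy g⁻¹.toPath e₀) :=
  funext fun _ => congrArg Subtype.val (hp.monodromy_trans_apply ..)

/-- Applying `g` to `y` prepends `g⁻¹` to the projected path class. -/
theorem transport_deckMap (g : FundamentalGroup X x₀) (a : q ⁻¹' {x₀}) (y : E) :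
    transport hp e₀ hq a (deckMap hp e₀ g y)
      = transport hp e₀ hq (hq.monodromy g⁻¹.toPath a) y := by
  unfold transport deckMap
  rw [projClass_monodromy]
  exact (hq.monodromy_cast_val ..).trans (congrArg Subtype.val (hq.monodromy_trans_apply ..))

theorem exists_deckMap_eq {y z : E} (h : p y = p z) :
    ∃ g : FundamentalGroup X x₀, deckMap hp e₀ g y = z := by
  obtain ⟨a, ha⟩ := exists_transport_eq hp e₀ hp (x₀ := x₀) h.symm
  obtain ⟨g, hg⟩ := hp.exists_monodromy_eq e₀ a
  -- The inverse appears because `deckMap` of `g` lifts `g⁻¹`.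
  refine ⟨(g : FundamentalGroup X x₀)⁻¹, ?_⟩
  rw [deckMap_eq_transport, inv_inv, ← ha, ← hg]

end Transport

/-! ### Sections of a covering and equivariant maps -/

/-- Lift the homotopy starting at `s`; its end at time 1 lies strictly over `f`. -/
theorem IsCoveringMap.exists_section_of_homotopic {F X : Type*} [TopologicalSpace F]
    [TopologicalSpace X] {q : C(F, X)} (hq : IsCoveringMap q) {A : Type*} [TopologicalSpace A]
    {f : C(A, X)} {s : C(A, F)} (h : (q.comp s).Homotopic f) : ∃ s' : C(A, F), q.comp s' = f := by
  obtain ⟨H⟩ := h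
  let K := hq.liftHomotopy H.toContinuousMap s fun a => H.apply_zero a
  refine ⟨⟨fun a => K (1, a), by fun_prop⟩, ?_⟩
  ext a
  exact (congrFun (hq.liftHomotopy_lifts H.toContinuousMap s fun a => H.apply_zero a) (1, a)).trans
    (H.apply_one a)

theorem continuous_apply_discrete {A C Y F : Type*} [TopologicalSpace A] [TopologicalSpace C]
    [DiscreteTopology C] [TopologicalSpace Y] [TopologicalSpace F] {T : C → A → F}
    (hT : ∀ c, Continuous (T c)) {φ : Y → C} (hφ : Continuous φ) {ψ : Y → A} (hψ : Continuous ψ) :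
    Continuous fun y => T (φ y) (ψ y) :=
  (continuous_prod_of_discrete_left (f := Function.uncurry T).2 hT).comp (hφ.prodMk hψ)

section Comparison

variable {E X F : Type*} [TopologicalSpace E] [TopologicalSpace X] [TopologicalSpace F]
  [SimplyConnectedSpace E] [PathConnectedSpace F]
  {p : C(E, X)} (hp : IsCoveringMap p) {q : C(F, X)} (hq : IsCoveringMap q)
  {x₀ : X} (e₀ : p ⁻¹' {x₀}) (a₀ : q ⁻¹' {x₀}) {n : ℕ}

theorem transport_coset_deckMap (g : FundamentalGroup X x₀)
    (c : CosetSpace (coveringSubgroup q a₀)) (y : E) :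
    transport hp e₀ hq (cosetEquivFiber hq a₀ (g • c)) (deckMap hp e₀ g y)
      = transport hp e₀ hq (cosetEquivFiber hq a₀ c) y := by
  rw [transport_deckMap, ← cosetEquivFiber_smul, inv_smul_smul]

variable [LocallyPathConnectedSpace E]

theorem continuous_deckMap (g : FundamentalGroup X x₀) : Continuous (deckMap hp e₀ g) := by
  rw [deckMap_eq_transport]
  exact continuous_transport hp e₀ hp _

include hq in
theorem SecatLE.genusLE (h : SecatLE q n) :
    letI : MulAction (FundamentalGroup X x₀) E := deckAction hp e₀
    GenusLE (FundamentalGroup X x₀) (fun _ : Unit => CosetSpace (coveringSubgroup q a₀)) E n := by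
  let _ : MulAction (FundamentalGroup X x₀) E := deckAction hp e₀
  obtain ⟨U, hUo, hU, hs⟩ := h
  refine ⟨fun i => ⟨p ⁻¹' U i, fun g y hy => ?_⟩, fun i => (hUo i).preimage p.continuous, ?_,
    fun i => ?_⟩
  · change p (deckMap hp e₀ g y) ∈ U i
    rwa [proj_deckMap hp e₀ g y]
  · change ⋃ i, p ⁻¹' U i = univ
    rw [← preimage_iUnion, hU, preimage_univ]
  obtain ⟨s₀, hs₀⟩ := hs i
  obtain ⟨s, hs⟩ := hq.exists_section_of_homotopic hs₀
  have hqs (x : U i) : q (s x) = x := DFunLike.congr_fun hs x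
  have hex (y : p ⁻¹' U i) : ∃ c : CosetSpace (coveringSubgroup q a₀),
      transport hp e₀ hq (cosetEquivFiber hq a₀ c) y.1 = s ⟨p y.1, y.2⟩ := by
    obtain ⟨a, ha⟩ := exists_transport_eq hp e₀ hq (y := y.1) (hqs ⟨p y.1, y.2⟩)
    exact ⟨(cosetEquivFiber hq a₀).symm a, by rwa [Equiv.apply_symm_apply]⟩
  choose φ hφ using hex
  have huniq (y : p ⁻¹' U i) (c) (hc : transport hp e₀ hq (cosetEquivFiber hq a₀ c) y.1
      = s ⟨p y.1, y.2⟩) : φ y = c :=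
    (cosetEquivFiber hq a₀).injective (transport_injective hp e₀ hq y.1 ((hφ y).trans hc.symm))
  refine ⟨(), ⟨φ, fun g y => huniq _ _ ?_⟩, ?_⟩
  · refine (transport_coset_deckMap hp hq e₀ a₀ g (φ y) y.1).trans ((hφ y).trans ?_)
    exact congrArg s (Subtype.ext (proj_deckMap hp e₀ g y.1).symm)
  -- Each level set of `φ` is where two lifts of `p` through `q` agree, hence open.
  · refine continuous_discrete_rng.2 fun c => ?_
    have hset : φ ⁻¹' {c} = {y : p ⁻¹' U i |
        transport hp e₀ hq (cosetEquivFiber hq a₀ c) y.1 = s ⟨p y.1, y.2⟩} :=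
      ext fun y => ⟨fun hy => mem_singleton_iff.1 hy ▸ hφ y, huniq y c⟩
    change IsOpen (φ ⁻¹' {c})
    rw [hset]
    refine hq.isLocalHomeomorph.isLocallyInjective.isOpen_eqLocus
      ((continuous_transport hp e₀ hq _).comp continuous_subtype_val) (by fun_prop) ?_
    ext y
    exact (proj_transport hp e₀ hq _ y.1).trans (hqs ⟨p y.1, y.2⟩).symm

include hq in
theorem SecatLE.of_genusLE [PathConnectedSpace X]
    (h : letI : MulAction (FundamentalGroup X x₀) E := deckAction hp e₀
      GenusLE (FundamentalGroup X x₀) (fun _ : Unit => CosetSpace (coveringSubgroup q a₀)) E n) :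
    SecatLE q n := by
  let _ : MulAction (FundamentalGroup X x₀) E := deckAction hp e₀
  obtain ⟨V, hVo, hV, hφ⟩ := h
  refine ⟨fun i => p '' (V i : Set E), fun i => hp.isOpenMap _ (hVo i), ?_, fun i => ?_⟩
  · rw [← image_iUnion, hV, image_univ, hp.surjective_of_nonempty.range_eq]
  obtain ⟨_, φ, hφc⟩ := hφ i
  let σ : V i → F := fun y => transport hp e₀ hq (cosetEquivFiber hq a₀ (φ y)) y.1
  have hσ : Continuous σ := by
    refine continuous_apply_discrete (T := fun c => transport hp e₀ hq (cosetEquivFiber hq a₀ c))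
      (fun c => continuous_transport hp e₀ hq _) (φ := fun y : V i => φ y) ?_ continuous_subtype_val
    exact hφc
  let r : C(V i, p '' (V i : Set E)) := ⟨fun y => ⟨p y.1, mem_image_of_mem p y.2⟩, by fun_prop⟩
  have hr : IsQuotientMap r := by
    refine IsOpenMap.isQuotientMap ?_ r.continuous ?_
    · exact (hp.isOpenMap.comp (hVo i).isOpenMap_subtype_val).subtype_mk _
    · rintro ⟨_, y, hy, rfl⟩
      exact ⟨⟨y, hy⟩, rfl⟩
  -- Points of `V i` with the same projection differ by a deck transformation, under which
  -- equivariance of `φ` makes `σ` invariant.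
  have hσr (y z : V i) (hyz : r y = r z) : σ y = σ z := by
    obtain ⟨g, hg⟩ := exists_deckMap_eq hp e₀ (congrArg Subtype.val hyz)
    obtain rfl : g • y = z := Subtype.ext hg
    simp only [σ, map_smul]
    exact (transport_coset_deckMap hp hq e₀ a₀ g (φ y) y.1).symm
  let s : C(p '' (V i : Set E), F) := hr.lift ⟨σ, hσ⟩ hσr
  have hs : q.comp s = ⟨Subtype.val, continuous_subtype_val⟩ := by
    ext x
    obtain ⟨y, rfl⟩ := hr.surjective x
    have : s (r y) = σ y := DFunLike.congr_fun (hr.lift_comp ⟨σ, hσ⟩ hσr) y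
    change q (s (r y)) = p y.1
    rw [this]
    exact proj_transport hp e₀ hq _ y.1
  exact ⟨s, hs ▸ .refl _⟩

end Comparison

theorem theorem2p2 {X : Type*} [TopologicalSpace X] [T2Space X] [PathConnectedSpace X]
    [Topology.CWComplex (Set.univ : Set X)]
    {X_hat : Type*} [TopologicalSpace X_hat] [ConnectedSpace X_hat]
    (q : C(X_hat, X)) (hq : IsCoveringMap q)
    {X_univ : Type*} [TopologicalSpace X_univ] [SimplyConnectedSpace X_univ]
    (p : C(X_univ, X)) (hp : IsCoveringMap p)
    (x₀ : X) (a₀ : q ⁻¹' {x₀}) (e₀ : p ⁻¹' {x₀}) :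
    letI : MulAction (FundamentalGroup X x₀) X_univ := deckAction hp e₀
    (∀ g : FundamentalGroup X x₀, Continuous fun y : X_univ => g • y) ∧
      secat q =
        genus (FundamentalGroup X x₀) (fun _ : Unit => CosetSpace (coveringSubgroup q a₀))
          X_univ := by
  have : LocallyPathConnectedSpace X := locallyPathConnectedSpace_of_CWComplex
  have : LocallyPathConnectedSpace X_univ := hp.isLocalHomeomorph.locallyPathConnectedSpace
  have : LocallyPathConnectedSpace X_hat := hq.isLocalHomeomorph.locallyPathConnectedSpace
  have : PathConnectedSpace X_hat := .of_locallyPathConnectedSpace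
  refine ⟨continuous_deckMap hp e₀, ?_⟩
  exact iInf_congr fun n => iInf_congr_Prop
    ⟨SecatLE.genusLE hp hq e₀ a₀, SecatLE.of_genusLE hp hq e₀ a₀⟩ fun _ => rfl
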